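/- Let $n,k\ge 1$ be integers. A cake cutting instance with $n$ players consists of the cake $[0,1]$ and, for each player $i\in\{1,\dots,n\}$, a continuous density $d_i:[0,1]\to[0,\infty)$ with $\int_0^1 d_i=1$; player $i$ values $A\subseteq[0,1]$ at $V_i(A)=\int_A d_i$. For $k\ge1$, a $k$-piece allocation is a partition of the whole cake $[0,1]$ into portions $A_1,\dots,A_n$, where each $A_i$ is a union of at most $k$ disjoint intervals. It is envy-free if $V_i(A_i)\ge V_i(A_j)$ for all $i,j$, and its utilitarian welfare is $\sum_i V_i(A_i)$. For an instance $I$ let $W_k(I)$ be the supremum of the utilitarian welfare over the envy-free $k$-piece allocations of $I$, and let $$\mathrm{POIU}_f(n,k)=\sup_I \frac{W_k(I)}{W_1(I)},$$ the supremum being over all instances $I$ with $n$ players (that have an envy-free $1$-piece allocation). Then $$\mathrm{POIU}_f(n,k)\ge k\quad\text{if } k\le n,\qquad\qquad \mathrm{POIU}_f(n,k)=n\quad\text{if } k>n.$$ -/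

import Mathlib

/-- A cake cutting instance with `n` players. The cake is the interval `[0, 1]`, and each player
has a continuous nonnegative value density on it with total value `1`. -/
structure CakeInstance (n : ℕ) where
  density : Fin n → ℝ → ℝ
  continuousOn_density : ∀ i, ContinuousOn (density i) (Set.Icc 0 1)
  density_nonneg : ∀ i, ∀ x ∈ Set.Icc (0 : ℝ) 1, 0 ≤ density i x
  integral_density : ∀ i, ∫ x in Set.Icc (0 : ℝ) 1, density i x = 1

namespace CakeInstance

variable {n : ℕ}

/-- The value of the portion `A ⊆ [0, 1]` to player `i`. -/
noncomputable def value (I : CakeInstance n) (i : Fin n) (A : Set ℝ) : ℝ :=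
  ∫ x in A, I.density i x

/-- `A` consists of at most `k` disjoint pieces. A piece is an interval of any kind: open, closed,
half-open, degenerate or empty (the last is why this says "at most" `k`). -/
def IsPortion (k : ℕ) (A : Set ℝ) : Prop :=
  ∃ P : Fin k → Set ℝ,
    (∀ j, (P j).OrdConnected) ∧ (Pairwise fun j l => Disjoint (P j) (P l)) ∧ A = ⋃ j, P j

/-- `Allocations(k)`: divisions of the whole cake `[0, 1]` among `n` players into mutually disjoint
portions, each consisting of at most `k` disjoint pieces. -/
def allocations (n k : ℕ) : Set (Fin n → Set ℝ) :=
  {A | (∀ i, IsPortion k (A i)) ∧ (Pairwise fun i j => Disjoint (A i) (A j)) ∧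
    ⋃ i, A i = Set.Icc (0 : ℝ) 1}

/-- No player prefers the portion of another player to her own. -/
def EnvyFree (I : CakeInstance n) (A : Fin n → Set ℝ) : Prop :=
  ∀ i j, I.value i (A j) ≤ I.value i (A i)

/-- `Allocations_f(k)(I)`: the envy-free members of `Allocations(k)`. -/
def envyFreeAllocations (I : CakeInstance n) (k : ℕ) : Set (Fin n → Set ℝ) :=
  {A | A ∈ allocations n k ∧ I.EnvyFree A}

/-- Utilitarian welfare: the sum of the players' utilities. -/
noncomputable def utilitarianWelfare (I : CakeInstance n) (A : Fin n → Set ℝ) : ℝ :=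
  ∑ i, I.value i (A i)

/-- The optimal utilitarian welfare over `Allocations_f(k)(I)`. The welfares lie in `[0, n]`, so the
supremum is taken over a bounded set. -/
noncomputable def optEnvyFreeWelfare (I : CakeInstance n) (k : ℕ) : ℝ :=
  sSup (I.utilitarianWelfare '' I.envyFreeAllocations k)

/-- The gain `τ_f(n, k, I)` of the instance `I`. An instance without envy-free contiguous
allocations would get the gain `0` here, and so would not contribute to the supremum below. -/
noncomputable def envyFreeGain (I : CakeInstance n) (k : ℕ) : ℝ :=
  I.optEnvyFreeWelfare k / I.optEnvyFreeWelfare 1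

end CakeInstance

/-- `POIU_f(n, k)`: the price of indivisibility for utilitarian welfare under envy-freeness, the
supremum of the gain over all cake cutting instances with `n` players. If the gains were unbounded
this real supremum would be `0`, so that a positive lower bound on it includes boundedness. -/
noncomputable def POIUf (n k : ℕ) : ℝ :=
  ⨆ I : CakeInstance n, I.envyFreeGain k

/-! The upper bound `n` is general: each player's own portion is worth at most 1, and at least 1/n
under envy-freeness, so welfares lie between 1 and `n`.

For the lower bound, cut the cake into `n` equal blocks, each worth 1/n to everybody, with positive
densities. Envy-free intervals are worth at least 1/n to their owners, so none fits properly inside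
a block. Counting the intervals on either side of a block boundary shows that none straddles it
(`not_straddle`). So every interval lies in one block, and contiguous welfare is at most 1;
allotting the blocks attains it.

Inside each block the masses are placed on `k` cells (`exists_density_of_masses`): player `i` puts
nearly everything in block `i + r` (mod `n`) on cell `r`, for `r < k`. Giving player `i` exactly
these `k` cells yields nearly k/n each. No cell is worth more than that share of a block to anyone,
so there is no envy, and the welfare is nearly `k`. For more than `n` pieces, the construction with
`n` cells per block already reaches `n`. -/

/-! ### Packing large intervals between given points -/

/-- Pairwise disjoint order-connected sets, none of which fits below a point `x < y (m + 1)` inside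
`[y m, x]`: at most `m` of them stay away from `y (m + 1)` on its left. -/
theorem card_le_of_bounded_left {α ι : Type*} [LinearOrder α] {n : ℕ} {A : ι → Set α}
    (hA : ∀ j, (A j).OrdConnected) (hd : Pairwise fun i j => Disjoint (A i) (A j))
    {y : ℕ → α} (h0 : ∀ j, A j ⊆ Set.Ici (y 0))
    (hy : ∀ j, ∀ m < n, ∀ x < y (m + 1), ¬ A j ⊆ Set.Icc (y m) x) {m : ℕ} (hm : m < n)
    (S : Finset ι) (hS : ∀ j ∈ S, ∃ x < y (m + 1), A j ⊆ Set.Iic x) : S.card ≤ m := by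
  classical
  induction m generalizing S with
  | zero =>
    rw [Nat.le_zero, Finset.card_eq_zero, Finset.eq_empty_iff_forall_notMem]
    intro j hj
    obtain ⟨x, hx, hx'⟩ := hS j hj
    exact hy j 0 hm x hx fun z hz => ⟨h0 j hz, hx' hz⟩
  | succ m ih =>
    have h1 := ih (by omega) {j ∈ S | ∃ x < y (m + 1), A j ⊆ Set.Iic x}
      fun j hj => (Finset.mem_filter.1 hj).2
    have key : ∀ j ∈ S, (∃ u ∈ A j, u < y (m + 1)) := by
      intro j hj
      obtain ⟨x, hx, hx'⟩ := hS j hj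
      by_contra! hc
      exact hy j (m + 1) hm x hx fun z hz => ⟨hc z hz, hx' hz⟩
    -- Each remaining set starts left of `y (m + 1)` and passes every point before it, so two of
    -- them would meet.
    have h2 : ({j ∈ S | ¬ ∃ x < y (m + 1), A j ⊆ Set.Iic x}).card ≤ 1 := by
      rw [Finset.card_le_one]
      have aux : ∀ i j u v, (¬ ∃ x < y (m + 1), A i ⊆ Set.Iic x) → u ∈ A i → v ∈ A j →
          v < y (m + 1) → u ≤ v → i = j := by
        intro i j u v hi hu hv hvy huv
        by_contra hij
        push Not at hi
        obtain ⟨z, hz, hvz⟩ := Set.not_subset.1 (hi v hvy)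
        exact Set.disjoint_left.1 (hd hij) ((hA i).out hu hz ⟨huv, (not_le.1 hvz).le⟩) hv
      intro i hi j hj
      rw [Finset.mem_filter] at hi hj
      obtain ⟨u, hu, huy⟩ := key i hi.1
      obtain ⟨v, hv, hvy⟩ := key j hj.1
      rcases le_total u v with h | h
      · exact aux i j u v hi.2 hu hv hvy h
      · exact (aux j i v u hj.2 hv hu huy h).symm
    have h3 := Finset.card_filter_add_card_filter_not (s := S)
      (fun j => ∃ x < y (m + 1), A j ⊆ Set.Iic x)
    omega

/-- If `n` pairwise disjoint order-connected sets between `y 0` and `y n` are so large that none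
fits into a proper initial or final part of some `[y m, y (m + 1)]`, then none of them extends to
both sides of one of the points `y m`. -/
theorem not_straddle {α : Type*} [LinearOrder α] {n : ℕ} {A : Fin n → Set α}
    (hA : ∀ j, (A j).OrdConnected) (hd : Pairwise fun i j => Disjoint (A i) (A j))
    {y : ℕ → α} (h0 : ∀ j, A j ⊆ Set.Ici (y 0)) (h1 : ∀ j, A j ⊆ Set.Iic (y n))
    (hl : ∀ j, ∀ m < n, ∀ x < y (m + 1), ¬ A j ⊆ Set.Icc (y m) x)
    (hr : ∀ j, ∀ m < n, ∀ x > y m, ¬ A j ⊆ Set.Icc x (y (m + 1)))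
    {m : ℕ} (hm : m + 1 < n) (j : Fin n) :
    A j ⊆ Set.Iic (y (m + 1)) ∨ A j ⊆ Set.Ici (y (m + 1)) := by
  classical
  by_contra! hc
  obtain ⟨v, hv, hyv⟩ := Set.not_subset.1 hc.1
  obtain ⟨u, hu, huy⟩ := Set.not_subset.1 hc.2
  rw [Set.mem_Iic, not_le] at hyv
  rw [Set.mem_Ici, not_le] at huy
  -- Every set other than `A j` avoids `[u, v]`, hence lies in `L` or `R`. The bounds `m` and `n - m
  -- - 2` then account for at most `n - 1` sets in all.
  let L : Finset (Fin n) := {i | ∃ x < y (m + 1), A i ⊆ Set.Iic x}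
  let R : Finset (Fin n) := {i | ∃ x > y (m + 1), A i ⊆ Set.Ici x}
  have hL := card_le_of_bounded_left hA hd h0 hl (m := m) (by omega)
    L fun i hi => (Finset.mem_filter.1 hi).2
  -- The bound on the right is the left one in the dual order, with the points `y` enumerated
  -- backwards.
  have hR := card_le_of_bounded_left (α := αᵒᵈ) (n := n)
    (A := fun i => OrderDual.ofDual ⁻¹' A i) (fun i => (hA i).dual)
    (fun i i' h => (hd h).preimage _) (y := fun l => OrderDual.toDual (y (n - l)))
    (fun i x hx => by
      simpa using! h1 i hx)
    (fun i l hln x hx hs => by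
      refine hr i (n - (l + 1)) (by omega) (OrderDual.ofDual x) hx fun z hz => ?_
      have := hs (a := OrderDual.toDual z) hz
      rw [show n - (l + 1) + 1 = n - l by omega]
      exact ⟨this.2, this.1⟩) (m := n - m - 2) (by omega)
    R (fun i hi => by
      obtain ⟨x, hx, hx'⟩ := (Finset.mem_filter.1 hi).2
      refine ⟨OrderDual.toDual x, ?_, fun z hz => hx' hz⟩
      rw [show n - (n - m - 2 + 1) = m + 1 by omega]
      exact hx)
  have hcov : (Finset.univ : Finset (Fin n)) ⊆ insert j (L ∪ R) := by
    intro i _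
    rcases eq_or_ne i j with rfl | hij
    · simp
    have hav : ∀ z ∈ A i, z < u ∨ v < z := by
      intro z hz
      by_contra! h
      exact Set.disjoint_left.1 (hd hij) hz ((hA j).out hu hv h)
    rw [Finset.mem_insert, Finset.mem_union, Finset.mem_filter, Finset.mem_filter]
    right
    by_cases h : A i ⊆ Set.Iic u
    · exact Or.inl ⟨Finset.mem_univ _, u, huy, h⟩
    · refine Or.inr ⟨Finset.mem_univ _, v, hyv, ?_⟩
      obtain ⟨w, hw, hwu⟩ := Set.not_subset.1 h
      have hvw : v < w := (hav w hw).resolve_left fun h' => hwu h'.le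
      intro z hz
      by_contra hzv
      have hzu : z < u := (hav z hz).resolve_right fun h' => hzv h'.le
      exact Set.disjoint_left.1 (hd hij)
        ((hA i).out hz hw ⟨hzu.le, ((huy.trans hyv).trans hvw).le⟩) hu
  have := Finset.card_le_card hcov
  have h2 := Finset.card_insert_le j (L ∪ R)
  have h3 := Finset.card_union_le L R
  rw [Finset.card_univ, Fintype.card_fin] at this
  omega

/-- Under the hypotheses of `not_straddle` each set lies in one of the intervals
`[y m, y (m + 1)]`. -/
theorem exists_subset_Icc_of_large {α : Type*} [LinearOrder α] {n : ℕ} {A : Fin n → Set α}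
    (hA : ∀ j, (A j).OrdConnected) (hd : Pairwise fun i j => Disjoint (A i) (A j))
    {y : ℕ → α} (h0 : ∀ j, A j ⊆ Set.Ici (y 0)) (h1 : ∀ j, A j ⊆ Set.Iic (y n))
    (hl : ∀ j, ∀ m < n, ∀ x < y (m + 1), ¬ A j ⊆ Set.Icc (y m) x)
    (hr : ∀ j, ∀ m < n, ∀ x > y m, ¬ A j ⊆ Set.Icc x (y (m + 1))) (j : Fin n) :
    ∃ m < n, A j ⊆ Set.Icc (y m) (y (m + 1)) := by
  have step : ∀ m < n, A j ⊆ Set.Ici (y m) ∨ ∃ l < n, A j ⊆ Set.Icc (y l) (y (l + 1)) := by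
    intro m hm
    induction m with
    | zero => exact Or.inl (h0 j)
    | succ m ih =>
      rcases ih (by omega) with h | h
      · rcases not_straddle hA hd h0 h1 hl hr hm j with h' | h'
        · exact Or.inr ⟨m, by omega, fun z hz => ⟨h hz, h' hz⟩⟩
        · exact Or.inl h'
      · exact Or.inr h
  have hn : 0 < n := j.pos
  rcases step (n - 1) (by omega) with h | h
  · refine ⟨n - 1, by omega, fun z hz => ⟨h hz, ?_⟩⟩
    rw [Nat.sub_add_cancel hn]
    exact h1 j hz
  · exact h

open MeasureTheory

/-! ### Values of portions -/

namespace CakeInstance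

theorem IsPortion.measurableSet {k : ℕ} {A : Set ℝ} (h : IsPortion k A) : MeasurableSet A := by
  obtain ⟨P, hP, -, rfl⟩ := h
  exact MeasurableSet.iUnion fun j => (hP j).measurableSet

theorem IsPortion.mono {k l : ℕ} (hkl : k ≤ l) {A : Set ℝ} (h : IsPortion k A) :
    IsPortion l A := by
  obtain ⟨P, hP, hd, rfl⟩ := h
  refine ⟨fun j => if hj : j.val < k then P ⟨j, hj⟩ else ∅, fun j => ?_, fun i j hij => ?_, ?_⟩
  · dsimp only
    split_ifs
    · exact hP _
    · exact Set.ordConnected_empty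
  · dsimp only
    split_ifs
    · exact hd fun h => hij (Fin.ext (Fin.mk.inj h))
    all_goals simp
  · ext x
    simp only [Set.mem_iUnion]
    constructor
    · rintro ⟨j, hj⟩
      exact ⟨j.castLE hkl, by simpa using hj⟩
    · rintro ⟨j, hj⟩
      split_ifs at hj with hjk
      · exact ⟨_, hj⟩
      · exact hj.elim

theorem ordConnected_of_isPortion_one {A : Set ℝ} (h : IsPortion 1 A) : A.OrdConnected := by
  obtain ⟨P, hP, -, rfl⟩ := h
  have : ⋃ j, P j = P 0 := by
    ext x
    simp [Fin.exists_fin_one]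
  rw [this]
  exact hP 0

theorem isPortion_one {A : Set ℝ} (h : A.OrdConnected) : IsPortion 1 A :=
  ⟨fun _ => A, fun _ => h, fun i j hij => (hij (Subsingleton.elim i j)).elim, by
    rw [Set.iUnion_const]⟩

variable {n : ℕ} (I : CakeInstance n)

theorem integrableOn_density (i : Fin n) : IntegrableOn (I.density i) (Set.Icc 0 1) :=
  (I.continuousOn_density i).integrableOn_Icc

theorem value_mono (i : Fin n) {A B : Set ℝ} (hAB : A ⊆ B) (hB : B ⊆ Set.Icc 0 1)
    (hm : MeasurableSet B) : I.value i A ≤ I.value i B :=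
  setIntegral_mono_set ((I.integrableOn_density i).mono_set hB)
    ((ae_restrict_iff' hm).2 (ae_of_all _ fun x hx => I.density_nonneg i x (hB hx)))
    hAB.eventuallyLE

theorem value_iUnion (i : Fin n) {ι : Type*} [Fintype ι] {A : ι → Set ℝ}
    (hm : ∀ j, MeasurableSet (A j)) (hd : Pairwise fun i j => Disjoint (A i) (A j))
    (hA : ∀ j, A j ⊆ Set.Icc 0 1) : I.value i (⋃ j, A j) = ∑ j, I.value i (A j) :=
  integral_iUnion_fintype hm hd fun j => (I.integrableOn_density i).mono_set (hA j)

variable {I} {k : ℕ} {A : Fin n → Set ℝ}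

theorem subset_of_mem_allocations (hA : A ∈ allocations n k) (i : Fin n) :
    A i ⊆ Set.Icc 0 1 :=
  hA.2.2 ▸ Set.subset_iUnion A i

theorem sum_value_eq_one (hA : A ∈ allocations n k) (i : Fin n) :
    ∑ j, I.value i (A j) = 1 := by
  rw [← I.value_iUnion i (fun j => (hA.1 j).measurableSet) hA.2.1 (subset_of_mem_allocations hA),
    hA.2.2]
  exact I.integral_density i

theorem value_le_one (hA : A ∈ allocations n k) (i : Fin n) : I.value i (A i) ≤ 1 :=
  (I.value_mono i (subset_of_mem_allocations hA i) subset_rfl measurableSet_Icc).trans_eq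
    (I.integral_density i)

theorem utilitarianWelfare_le (hA : A ∈ allocations n k) : I.utilitarianWelfare A ≤ n := by
  simpa [utilitarianWelfare] using Finset.sum_le_card_nsmul Finset.univ (fun i => I.value i (A i)) 1
    fun i _ => value_le_one hA i

theorem one_div_le_value (hA : A ∈ I.envyFreeAllocations k) (i : Fin n) :
    1 / (n : ℝ) ≤ I.value i (A i) := by
  have h := Finset.sum_le_card_nsmul Finset.univ (fun j => I.value i (A j)) _
    fun j _ => hA.2 i j
  rw [sum_value_eq_one hA.1] at h
  rw [div_le_iff₀ (by exact_mod_cast i.pos)]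
  simpa [mul_comm] using h

theorem one_le_utilitarianWelfare (hn : 1 ≤ n) (hA : A ∈ I.envyFreeAllocations k) :
    1 ≤ I.utilitarianWelfare A := by
  have h := Finset.card_nsmul_le_sum Finset.univ (fun i => I.value i (A i)) _
    fun i _ => one_div_le_value hA i
  have hn' : (n : ℝ) ≠ 0 := by positivity
  simpa [hn', utilitarianWelfare] using h

variable (I k)

theorem bddAbove_utilitarianWelfare :
    BddAbove (I.utilitarianWelfare '' I.envyFreeAllocations k) := by
  refine ⟨n, ?_⟩
  rintro _ ⟨A, hA, rfl⟩
  exact utilitarianWelfare_le hA.1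

theorem optEnvyFreeWelfare_le : I.optEnvyFreeWelfare k ≤ n := by
  refine Real.sSup_le ?_ n.cast_nonneg
  rintro _ ⟨A, hA, rfl⟩
  exact utilitarianWelfare_le hA.1

/-- The numerator is at most `n` and the denominator at least 1, unless no contiguous envy-free
allocation exists; then the denominator is `sSup ∅ = 0` and the quotient is 0. -/
theorem envyFreeGain_le (hn : 1 ≤ n) : I.envyFreeGain k ≤ n := by
  rw [envyFreeGain]
  rcases (I.envyFreeAllocations 1).eq_empty_or_nonempty with h | ⟨A, hA⟩
  · have h0 : I.optEnvyFreeWelfare 1 = 0 := by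
      rw [optEnvyFreeWelfare, h, Set.image_empty, Real.sSup_empty]
    rw [h0, div_zero]
    exact n.cast_nonneg
  · have h1 : 1 ≤ I.optEnvyFreeWelfare 1 :=
      (one_le_utilitarianWelfare hn hA).trans
        (le_csSup (I.bddAbove_utilitarianWelfare 1) ⟨A, hA, rfl⟩)
    rw [div_le_iff₀ (by linarith)]
    exact (I.optEnvyFreeWelfare_le k).trans (le_mul_of_one_le_right n.cast_nonneg h1)

end CakeInstance

theorem bddAbove_range_envyFreeGain {n : ℕ} (hn : 1 ≤ n) (k : ℕ) :
    BddAbove (Set.range fun I : CakeInstance n => I.envyFreeGain k) := by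
  refine ⟨n, ?_⟩
  rintro _ ⟨I, rfl⟩
  exact I.envyFreeGain_le k hn

/-! ### Instances with common quantiles -/

namespace CakeInstance

variable {n : ℕ} {I : CakeInstance n}

theorem value_Icc_eq (i : Fin n) {a b : ℝ} (hab : a ≤ b) :
    I.value i (Set.Icc a b) = ∫ x in a..b, I.density i x := by
  rw [intervalIntegral.integral_of_le hab, value, integral_Icc_eq_integral_Ioc]

/-- If the densities are continuous and positive and all players cut the cake into `n` equal parts
at the same points, then contiguous envy-free allocations have welfare at most `1`. -/
theorem utilitarianWelfare_le_one_of_common_quantiles (hc : ∀ i, Continuous (I.density i))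
    (hpos : ∀ i x, 0 < I.density i x) {y : ℕ → ℝ} (hy0 : y 0 = 0) (hyn : y n = 1)
    (hy : Monotone y) (hI : ∀ i, ∀ m < n, I.value i (Set.Icc (y m) (y (m + 1))) = 1 / n)
    {A : Fin n → Set ℝ} (hA : A ∈ I.envyFreeAllocations 1) : I.utilitarianWelfare A ≤ 1 := by
  have hsub := subset_of_mem_allocations hA.1
  have hii : ∀ i a b, IntervalIntegrable (I.density i) volume a b :=
    fun i a b => (hc i).intervalIntegrable a b
  have hunit : ∀ m < n, Set.Icc (y m) (y (m + 1)) ⊆ Set.Icc 0 1 := fun m hm =>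
    Set.Icc_subset_Icc (hy0 ▸ hy m.zero_le) (hyn ▸ hy (Nat.succ_le_of_lt hm))
  -- By positivity of the densities, a proper initial or final part of a block is worth strictly
  -- less than 1/n.
  have hlt : ∀ j, ∀ m < n, ∀ a b, y m ≤ a → b ≤ y (m + 1) → (y m < a ∨ b < y (m + 1)) →
      ¬ A j ⊆ Set.Icc a b := by
    intro j m hm a b ha hb hab hs
    have h1 := (one_div_le_value hA j).trans (I.value_mono j hs
      ((Set.Icc_subset_Icc ha hb).trans (hunit m hm)) measurableSet_Icc)
    have hn : (0 : ℝ) < 1 / n := by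
      have : 0 < n := j.pos
      positivity
    rcases le_or_gt a b with hle | hgt
    · have h2 := hI j m hm
      rw [value_Icc_eq j hle] at h1
      rw [value_Icc_eq j (hy m.le_succ),
        ← intervalIntegral.integral_add_adjacent_intervals (hii j _ a) (hii j a _),
        ← intervalIntegral.integral_add_adjacent_intervals (hii j a b) (hii j b _)] at h2
      have h3 := intervalIntegral.integral_nonneg (μ := volume) ha fun x _ => (hpos j x).le
      have h4 := intervalIntegral.integral_nonneg (μ := volume) hb fun x _ => (hpos j x).le
      rcases hab with h | h
      · have := intervalIntegral.intervalIntegral_pos_of_pos (hii j _ _) (hpos j) h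
        linarith
      · have := intervalIntegral.intervalIntegral_pos_of_pos (hii j _ _) (hpos j) h
        linarith
    · rw [Set.Icc_eq_empty hgt.not_ge, value, setIntegral_empty] at h1
      linarith
  have hle : ∀ j, I.value j (A j) ≤ 1 / n := by
    intro j
    obtain ⟨m, hm, hs⟩ := exists_subset_Icc_of_large (y := y)
      (fun j => ordConnected_of_isPortion_one (hA.1.1 j)) hA.1.2.1
      (fun j x hx => hy0 ▸ (hsub j hx).1) (fun j x hx => hyn ▸ (hsub j hx).2)
      (fun j m hm x hx => hlt j m hm _ _ le_rfl hx.le (Or.inr hx))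
      (fun j m hm x hx => hlt j m hm _ _ (le_of_lt hx) le_rfl (Or.inl hx)) j
    exact (I.value_mono j hs (hunit m hm) measurableSet_Icc).trans_eq (hI j m hm)
  have h := Finset.sum_le_card_nsmul Finset.univ (fun i => I.value i (A i)) _ fun i _ => hle i
  refine h.trans ?_
  rw [Finset.card_univ, Fintype.card_fin, nsmul_eq_mul]
  exact (mul_one_div _ _).trans_le (div_self_le_one _)

end CakeInstance

/-! ### The grid of `N` equal cells -/

/-- The index of the cell of length `1 / N` that contains `x ∈ [0, 1]`. -/
noncomputable def gridIndex (N : ℕ) (x : ℝ) : ℕ :=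
  min ⌊x * N⌋₊ (N - 1)

/-- The points of the cake whose cell index lies in `s`. -/
def gridSet (N : ℕ) (s : Set ℕ) : Set ℝ :=
  Set.Icc 0 1 ∩ gridIndex N ⁻¹' s

theorem gridIndex_mono (N : ℕ) : Monotone (gridIndex N) := fun _ _ h =>
  min_le_min_right _ (Nat.floor_mono (mul_le_mul_of_nonneg_right h N.cast_nonneg))

theorem gridIndex_lt {N : ℕ} (hN : 0 < N) (x : ℝ) : gridIndex N x < N :=
  (min_le_right _ _).trans_lt (Nat.sub_lt hN one_pos)

theorem gridSet_subset (N : ℕ) (s : Set ℕ) : gridSet N s ⊆ Set.Icc 0 1 :=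
  Set.inter_subset_left

theorem ordConnected_gridSet (N : ℕ) {s : Set ℕ} (hs : s.OrdConnected) :
    (gridSet N s).OrdConnected :=
  Set.ordConnected_Icc.inter (hs.preimage_mono (gridIndex_mono N))

theorem disjoint_gridSet (N : ℕ) {s t : Set ℕ} (h : Disjoint s t) :
    Disjoint (gridSet N s) (gridSet N t) :=
  (h.preimage _).mono Set.inter_subset_right Set.inter_subset_right

/-- Cells are half-open except the last, so they differ from closed intervals only at endpoints. -/
theorem gridSet_singleton_ae_eq {N m : ℕ} (hm : m < N) :
    gridSet N {m} =ᵐ[volume] Set.Icc ((m : ℝ) / N) ((m + 1 : ℕ) / N) := by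
  have hN : (0 : ℝ) < N := by exact_mod_cast m.zero_le.trans_lt hm
  have hmN : (m : ℝ) + 1 ≤ N := by exact_mod_cast hm
  refine Filter.EventuallyLE.antisymm (LE.le.eventuallyLE ?_)
    (Ioo_ae_eq_Icc.symm.le.trans (LE.le.eventuallyLE ?_))
  · rintro x ⟨⟨hx0, hx1⟩, hx⟩
    change min _ _ = m at hx
    constructor
    · rw [div_le_iff₀ hN]
      refine (Nat.le_floor_iff (by positivity)).1 ?_
      exact hx ▸ min_le_left _ _
    · rw [le_div_iff₀ hN]
      rcases min_choice ⌊x * N⌋₊ (N - 1) with h | h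
      · have := Nat.lt_floor_add_one (x * N)
        rw [h.symm.trans hx] at this
        push_cast
        exact this.le
      · have : m + 1 = N := by omega
        rw [this]
        nlinarith
  · rintro x ⟨hx0, hx1⟩
    rw [div_lt_iff₀ hN] at hx0
    rw [lt_div_iff₀ hN] at hx1
    push_cast at hx1
    refine ⟨⟨?_, ?_⟩, ?_⟩
    · by_contra! h
      nlinarith [(Nat.cast_nonneg m : (0 : ℝ) ≤ m)]
    · by_contra! h
      nlinarith
    · have : ⌊x * N⌋₊ = m :=
        (Nat.floor_eq_iff (m.cast_nonneg.trans hx0.le)).2 ⟨hx0.le, hx1⟩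
      change min _ _ = m
      omega

theorem integral_tent {a b : ℝ} (hab : a ≤ b) :
    ∫ x in a..b, max 0 ((x - a) * (b - x)) = (b - a) ^ 3 / 6 := by
  have h : ∫ x in a..b, max 0 ((x - a) * (b - x)) = ∫ x in a..b, (x - a) * (b - x) := by
    refine intervalIntegral.integral_congr fun x hx => ?_
    rw [Set.uIcc_of_le hab] at hx
    exact max_eq_right (mul_nonneg (sub_nonneg.2 hx.1) (sub_nonneg.2 hx.2))
  have hd : ∀ x, HasDerivAt (fun x : ℝ => -x ^ 3 / 3 + (a + b) * x ^ 2 / 2 - a * b * x)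
      ((x - a) * (b - x)) x := by
    intro x
    have h1 := ((hasDerivAt_pow 3 x).neg.div_const 3).add
      (((hasDerivAt_pow 2 x).const_mul (a + b)).div_const 2)
    have h2 := h1.sub ((hasDerivAt_id x).const_mul (a * b))
    exact h2.congr_deriv (by norm_num; ring)
  rw [h, intervalIntegral.integral_eq_sub_of_hasDerivAt (fun x _ => hd x)
    (by apply Continuous.intervalIntegrable; fun_prop)]
  ring

/-- A continuous density bounded below by `δ` with prescribed masses on the cells of the grid. -/
theorem exists_density_of_masses {N : ℕ} (hN : 0 < N) (δ : ℝ) {w : ℕ → ℝ} (hw : ∀ m, 0 ≤ w m) :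
    ∃ f : ℝ → ℝ, Continuous f ∧ (∀ x, δ ≤ f x) ∧
      ∀ m < N, ∫ x in ((m : ℝ) / N)..((m + 1 : ℕ) / N), f x = δ / N + w m := by
  have hN' : (0 : ℝ) < N := by exact_mod_cast hN
  -- A parabolic bump supported on cell `l`; its mass 1/(6N³) explains the normalising factor below.
  let t : ℕ → ℝ → ℝ := fun l x => max 0 ((x - (l : ℝ) / N) * (((l + 1 : ℕ) : ℝ) / N - x))
  have htc : ∀ l, Continuous (t l) := by
    intro l
    fun_prop
  have hmono : ∀ a b : ℕ, a ≤ b → (a : ℝ) / N ≤ b / N := fun a b h =>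
    div_le_div_of_nonneg_right (by exact_mod_cast h) hN'.le
  have hint : ∀ l m : ℕ, ∫ x in ((m : ℝ) / N)..((m + 1 : ℕ) / N), t l x =
      if l = m then 1 / (6 * (N : ℝ) ^ 3) else 0 := by
    intro l m
    split_ifs with h
    · subst h
      rw [integral_tent (hmono _ _ l.le_succ)]
      push_cast
      field_simp
      ring
    · rw [← intervalIntegral.integral_zero (a := (m : ℝ) / N) (b := ((m + 1 : ℕ) : ℝ) / N)]
      refine intervalIntegral.integral_congr fun x hx => ?_
      rw [Set.uIcc_of_le (hmono _ _ m.le_succ)] at hx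
      refine max_eq_left ?_
      rcases lt_or_gt_of_ne h with h | h
      · have := hmono (l + 1) m h
        have := hmono l (l + 1) l.le_succ
        exact mul_nonpos_of_nonneg_of_nonpos (by linarith [hx.1]) (by linarith [hx.1])
      · have := hmono (m + 1) l h
        have := hmono l (l + 1) l.le_succ
        exact mul_nonpos_of_nonpos_of_nonneg (by linarith [hx.2]) (by linarith [hx.2])
  refine ⟨fun x => δ + ∑ l ∈ Finset.range N, w l * (6 * (N : ℝ) ^ 3) * t l x, by fun_prop,
    fun x => le_add_of_nonneg_right (Finset.sum_nonneg fun l _ =>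
      mul_nonneg (mul_nonneg (hw l) (by positivity)) (le_max_left _ _)), fun m hm => ?_⟩
  rw [intervalIntegral.integral_add (by simp)
      (by apply Continuous.intervalIntegrable; fun_prop),
    intervalIntegral.integral_finsetSum
      fun l _ => by apply Continuous.intervalIntegrable; fun_prop]
  simp only [intervalIntegral.integral_const_mul, hint, intervalIntegral.integral_const]
  rw [Finset.sum_eq_single_of_mem m (Finset.mem_range.2 hm)
    fun l _ hl => by rw [if_neg hl, mul_zero]]
  rw [if_pos rfl]
  push_cast
  simp only [smul_eq_mul]
  field_simp
  ring

/-! ### Instances with prescribed cell values -/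

section cells

variable {n k : ℕ}

/-- The `r`-th of the `k` cells in the `b`-th of the `n` blocks of the grid. -/
def gridCell (c : Fin n × Fin k) : Set ℝ :=
  gridSet (n * k) {(finProdFinEquiv c : ℕ)}

theorem gridCell_subset (c : Fin n × Fin k) : gridCell c ⊆ Set.Icc 0 1 :=
  gridSet_subset _ _

theorem ordConnected_gridCell (c : Fin n × Fin k) : (gridCell c).OrdConnected :=
  ordConnected_gridSet _ Set.ordConnected_singleton

theorem measurableSet_gridCell (c : Fin n × Fin k) : MeasurableSet (gridCell c) :=
  (ordConnected_gridCell c).measurableSet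

theorem disjoint_gridCell {c d : Fin n × Fin k} (h : c ≠ d) :
    Disjoint (gridCell c) (gridCell d) := by
  refine disjoint_gridSet _ (Set.disjoint_singleton.2 fun h' => h ?_)
  exact finProdFinEquiv.injective (Fin.ext h')

theorem exists_mem_gridCell (hn : 0 < n) (hk : 0 < k) {x : ℝ} (hx : x ∈ Set.Icc (0 : ℝ) 1) :
    ∃ c : Fin n × Fin k, x ∈ gridCell c :=
  ⟨finProdFinEquiv.symm ⟨gridIndex (n * k) x, gridIndex_lt (Nat.mul_pos hn hk) x⟩, hx, by
    simp only [Equiv.apply_symm_apply, Set.mem_preimage, Set.mem_singleton_iff]⟩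

theorem iUnion_gridCell (hn : 0 < n) (hk : 0 < k) :
    ⋃ c : Fin n × Fin k, gridCell c = Set.Icc 0 1 :=
  (Set.iUnion_subset gridCell_subset).antisymm fun _ hx =>
    Set.mem_iUnion.2 (exists_mem_gridCell hn hk hx)

theorem iUnion_gridCell_block (hk : 0 < k) (b : Fin n) :
    ⋃ r : Fin k, gridCell (b, r) = gridSet (n * k) {m | m / k = b} := by
  ext x
  simp only [gridCell, gridSet, Set.mem_iUnion, Set.mem_inter_iff, Set.mem_preimage,
    Set.mem_singleton_iff, Set.mem_ofPred_eq, finProdFinEquiv_apply_val, exists_and_left]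
  refine and_congr_right fun _ => ⟨?_, fun h => ?_⟩
  · rintro ⟨r, hr⟩
    rw [hr, Nat.add_mul_div_left _ _ r.pos, Nat.div_eq_of_lt r.2, zero_add]
  · exact ⟨⟨gridIndex (n * k) x % k, Nat.mod_lt _ hk⟩, by rw [← h, Nat.mod_add_div]⟩

/-- The floor `δ` keeps densities positive, and `hsum` makes block boundaries common quantiles, as
`utilitarianWelfare_le_one_of_common_quantiles` requires. -/
theorem exists_instance_of_cell_values (hn : 0 < n) (hk : 0 < k) {δ : ℝ} (hδ : 0 < δ)
    {w : Fin n → Fin n × Fin k → ℝ} (hw : ∀ i c, 0 ≤ w i c)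
    (hsum : ∀ i b, ∑ r, (δ / (n * k : ℕ) + w i (b, r)) = 1 / n) :
    ∃ I : CakeInstance n, (∀ i, Continuous (I.density i)) ∧ (∀ i x, 0 < I.density i x) ∧
      (∀ i c, I.value i (gridCell c) = δ / (n * k : ℕ) + w i c) ∧
      ∀ i, ∀ b < n, I.value i (Set.Icc ((b : ℝ) / n) ((b + 1 : ℕ) / n)) = 1 / n := by
  have hN : 0 < n * k := Nat.mul_pos hn hk
  have hn' : (0 : ℝ) < n := by exact_mod_cast hn
  have hk' : (0 : ℝ) < k := by exact_mod_cast hk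
  choose f hfc hfδ hf using fun i => exists_density_of_masses hN δ
    (w := fun m => if h : m < n * k then w i (finProdFinEquiv.symm ⟨m, h⟩) else 0)
    fun m => by
      split_ifs
      · exact hw _ _
      · exact le_rfl
  have hfN : ∀ i (c : Fin n × Fin k),
      ∫ x in (((finProdFinEquiv c : Fin (n * k)) : ℕ) : ℝ) / (n * k : ℕ)..
        (((finProdFinEquiv c : Fin (n * k)) : ℕ) + 1 : ℕ) / (n * k : ℕ), f i x =
      δ / (n * k : ℕ) + w i c := by
    intro i c
    rw [hf i _ (finProdFinEquiv c).2, dif_pos (finProdFinEquiv c).2, Fin.eta,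
      Equiv.symm_apply_apply]
  have hcell : ∀ i (c : Fin n × Fin k),
      ∫ x in gridCell c, f i x = δ / (n * k : ℕ) + w i c := by
    intro i c
    rw [gridCell, setIntegral_congr_set (gridSet_singleton_ae_eq (finProdFinEquiv c).2),
      integral_Icc_eq_integral_Ioc, ← intervalIntegral.integral_of_le, hfN]
    exact div_le_div_of_nonneg_right (by push_cast; linarith) (Nat.cast_nonneg _)
  have hcont : ∀ i, ContinuousOn (f i) (Set.Icc 0 1) := fun i => (hfc i).continuousOn
  refine ⟨⟨f, hcont, fun i x _ => hδ.le.trans (hfδ i x), fun i => ?_⟩, hfc,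
    fun i x => hδ.trans_le (hfδ i x), hcell, fun i b hb => ?_⟩
  · rw [← iUnion_gridCell hn hk, integral_iUnion_fintype measurableSet_gridCell
      (fun _ _ h => disjoint_gridCell h)
      fun c => (hcont i).integrableOn_Icc.mono_set (gridCell_subset c)]
    simp only [hcell]
    rw [Fintype.sum_prod_type]
    simp only [hsum]
    simp [hn'.ne']
  · have hadj := intervalIntegral.sum_integral_adjacent_intervals (μ := volume) (f := f i)
      (a := fun r : ℕ => ((r + k * b : ℕ) : ℝ) / (n * k : ℕ)) (n := k)
      fun r _ => (hfc i).intervalIntegrable _ _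
    have h0 : ((0 + k * b : ℕ) : ℝ) / (n * k : ℕ) = b / n := by
      push_cast
      field_simp
      ring
    have h1 : ((k + k * b : ℕ) : ℝ) / (n * k : ℕ) = (b + 1 : ℕ) / n := by
      push_cast
      field_simp
      ring
    rw [h0, h1] at hadj
    rw [CakeInstance.value_Icc_eq i
      (div_le_div_of_nonneg_right (by push_cast; linarith) hn'.le)]
    refine hadj.symm.trans ?_
    rw [Finset.sum_range, ← hsum i ⟨b, hb⟩]
    refine Finset.sum_congr rfl fun r _ => ?_
    rw [← hfN i (⟨b, hb⟩, r), finProdFinEquiv_apply_val]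
    simp only [Nat.add_right_comm]

end cells

/-! ### The extremal instances and the final bounds -/

open CakeInstance

/-- There are instances whose contiguous envy-free optimum is `1` and which have envy-free
allocations into `k` pieces of welfare close to `k`. -/
theorem exists_instance_of_welfare {n k l : ℕ} (hk : 1 ≤ k) (hkn : k ≤ n) (hkl : k ≤ l) {ε : ℝ}
    (hε : 0 < ε) (hε1 : ε ≤ 1) :
    ∃ I : CakeInstance n, I.optEnvyFreeWelfare 1 = 1 ∧
      (1 - ε) * k ≤ I.optEnvyFreeWelfare l := by
  have hn : 0 < n := by omega
  have : NeZero n := ⟨hn.ne'⟩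
  have hn' : (0 : ℝ) < n := by exact_mod_cast hn
  have hk' : (0 : ℝ) < k := by exact_mod_cast hk
  have hε' : 0 ≤ (1 - ε) / n := div_nonneg (by linarith) hn'.le
  -- The subtraction is modulo `n`. The cap at `k - 1` only selects some cell in the blocks from
  -- which player `i` will receive nothing.
  let w : Fin n → Fin n × Fin k → ℝ := fun i c =>
    if (c.2 : ℕ) = min (c.1 - i).val (k - 1) then (1 - ε) / n else 0
  have hw : ∀ i c, 0 ≤ w i c ∧ w i c ≤ (1 - ε) / n := by
    intro i c
    dsimp only [w]
    split_ifs
    · exact ⟨hε', le_rfl⟩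
    · exact ⟨le_rfl, hε'⟩
  have hsum : ∀ i b, ∑ r, (ε / (n * k : ℕ) + w i (b, r)) = 1 / n := by
    intro i b
    have : ∀ r : Fin k, (r : ℕ) = min (b - i).val (k - 1) ↔
        r = ⟨min (b - i).val (k - 1), by omega⟩ := fun r => by rw [Fin.ext_iff]
    simp only [w, this, Finset.sum_add_distrib, Finset.sum_ite_eq', Finset.mem_univ, if_true,
      Finset.sum_const, Finset.card_univ, Fintype.card_fin, nsmul_eq_mul]
    push_cast
    field_simp
    ring
  obtain ⟨I, hc, hpos, hcell, hblock⟩ :=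
    exists_instance_of_cell_values hn hk hε (fun i c => (hw i c).1) hsum
  have hvalue : ∀ i (s : Fin k → Fin n × Fin k), Function.Injective s →
      I.value i (⋃ r, gridCell (s r)) = ∑ r, I.value i (gridCell (s r)) := fun i s hs =>
    I.value_iUnion i (fun r => measurableSet_gridCell _)
      (fun r t h => disjoint_gridCell (hs.ne h)) fun r => gridCell_subset _
  refine ⟨I, IsGreatest.csSup_eq ⟨?_, ?_⟩, ?_⟩
  · have hv : ∀ (i b : Fin n), I.value i (⋃ r : Fin k, gridCell (b, r)) = 1 / n := by
      intro i b
      rw [hvalue i (fun r => (b, r)) fun r t h => congrArg Prod.snd h]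
      simp only [hcell, hsum]
    refine ⟨fun b => ⋃ r : Fin k, gridCell (b, r), ⟨⟨fun b => ?_, fun b b' h => ?_, ?_⟩,
      fun i j => ?_⟩, ?_⟩
    · dsimp only
      rw [iUnion_gridCell_block hk]
      refine isPortion_one (ordConnected_gridSet _ ?_)
      exact Set.ordConnected_singleton.preimage_mono fun a b h => Nat.div_le_div_right h
    · simp only [Set.disjoint_iUnion_left, Set.disjoint_iUnion_right]
      exact fun r r' => disjoint_gridCell fun h' => h (congrArg Prod.fst h')
    · rw [← iUnion_gridCell hn hk, Set.iUnion_prod']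
    · exact (hv i j).le.trans (hv i i).ge
    · simp only [utilitarianWelfare, hv]
      simp [hn'.ne']
  · rintro _ ⟨A, hA, rfl⟩
    refine utilitarianWelfare_le_one_of_common_quantiles hc hpos (y := fun b => (b : ℝ) / n)
      (by simp) (div_self hn'.ne') (fun a b h => ?_) hblock hA
    exact div_le_div_of_nonneg_right (by exact_mod_cast h) hn'.le
  -- Player `i` takes her favoured cell in blocks `i, …, i + k - 1` modulo `n`; for fixed `r` the
  -- shift is a bijection of blocks, so the cells are partitioned.
  · let s : Fin n → Fin k → Fin n × Fin k := fun i r => (i + r.castLE hkn, r)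
    have hs : ∀ i, Function.Injective (s i) := fun i r t h => congrArg Prod.snd h
    have hown : ∀ i r, I.value i (gridCell (s i r)) = ε / (n * k : ℕ) + (1 - ε) / n := by
      intro i r
      rw [hcell]
      refine congrArg _ (if_pos ?_)
      dsimp only [s]
      rw [add_sub_cancel_left, Fin.val_castLE, min_eq_left (by omega)]
    have hle : ∀ (i : Fin n) (c : Fin n × Fin k),
        I.value i (gridCell c) ≤ ε / (n * k : ℕ) + (1 - ε) / n := by
      intro i c
      rw [hcell]
      exact add_le_add_right (hw i c).2 _
    have hmem : (fun i => ⋃ r, gridCell (s i r)) ∈ I.envyFreeAllocations l := by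
      refine ⟨⟨fun i => IsPortion.mono hkl ⟨_, fun r => ordConnected_gridCell _,
        fun r t h => disjoint_gridCell ((hs i).ne h), rfl⟩, fun i j h => ?_, ?_⟩, fun i j => ?_⟩
      · simp only [Set.disjoint_iUnion_left, Set.disjoint_iUnion_right]
        refine fun r t => disjoint_gridCell fun h' => h ?_
        obtain ⟨h1, h2⟩ := Prod.mk.inj h'
        subst h2
        exact add_right_cancel h1
      · refine (Set.iUnion_subset fun i => Set.iUnion_subset fun r =>
          gridCell_subset _).antisymm fun x hx => ?_
        obtain ⟨⟨b, r⟩, hb⟩ := exists_mem_gridCell hn hk hx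
        refine Set.mem_iUnion₂.2 ⟨b - r.castLE hkn, r, ?_⟩
        simpa only [s, sub_add_cancel] using hb
      · rw [hvalue i _ (hs i), hvalue i _ (hs j)]
        exact Finset.sum_le_sum fun r _ => (hle i _).trans (hown i r).ge
    refine le_trans ?_ (le_csSup (I.bddAbove_utilitarianWelfare l) ⟨_, hmem, rfl⟩)
    simp only [utilitarianWelfare, hvalue _ _ (hs _), hown, Finset.sum_const, Finset.card_univ,
      Fintype.card_fin, nsmul_eq_mul]
    have : (n : ℝ) * (k * (ε / (n * k : ℕ) + (1 - ε) / n)) = ε + (1 - ε) * k := by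
      push_cast
      field_simp
    linarith

/-- Allowing `l ≥ k` pieces lets the same construction serve more pieces than players. -/
theorem le_POIUf {n k l : ℕ} (hk : 1 ≤ k) (hkn : k ≤ n) (hkl : k ≤ l) :
    (k : ℝ) ≤ POIUf n l := by
  have hk' : (0 : ℝ) < k := by exact_mod_cast hk
  refine le_of_forall_pos_sub_le fun η hη => ?_
  -- With `ε = min (η / k) 1` the loss `ε * k` is at most `η`.
  obtain ⟨I, h1, hl⟩ := exists_instance_of_welfare hk hkn hkl
    (lt_min (div_pos hη hk') one_pos) (min_le_right _ _)
  have h2 := le_ciSup (bddAbove_range_envyFreeGain (hk.trans hkn) l) I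
  rw [envyFreeGain, h1, div_one] at h2
  refine le_trans ?_ (hl.trans h2)
  have h3 := mul_le_mul_of_nonneg_right (min_le_left (η / k) 1) hk'.le
  rw [div_mul_cancel₀ _ hk'.ne'] at h3
  linarith

theorem theorem3p20 (n k : ℕ) (hn : 1 ≤ n) (hk : 1 ≤ k) :
    (k ≤ n → (k : ℝ) ≤ POIUf n k) ∧ (n < k → POIUf n k = (n : ℝ)) := by
  refine ⟨fun h => le_POIUf hk h le_rfl, fun h => le_antisymm ?_ (le_POIUf hn le_rfl h.le)⟩
  exact Real.iSup_le (fun I => I.envyFreeGain_le k hn) n.cast_nonneg
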